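/- Let $M$ be a connected, Hausdorff, second countable smooth manifold of dimension $n+1\ge 1$, equipped with a Lorentzian metric $g$ of class $C^{1,1}$ (in particular, possibly of class $C^2$ or smooth) and signature $(-,+,\dots,+)$, and with a time orientation. For $p,q\in M$ write $p\le q$ if $p=q$ or there is a future-directed piecewise $C^1$ causal curve from $p$ to $q$, and for $A\subset M$ set $$J^+(A)=\{q\in M: p\le q \text{ for some } p\in A\},\qquad J^-(A)=\{q\in M: q\le p\text{ for some }p\in A\},$$ with $J^\pm(p)=J^\pm(\{p\})$. Then: 1. the causal diamonds $J^+(p)\cap J^-(q)$ are closed for all $p,q\in M$ if and only if the causally convex hull $J^+(K)\cap J^-(K)$ is closed for every compact $K\subset M$; 2. the causal diamonds $J^+(p)\cap J^-(q)$ are compact for all $p,q\in M$ if and only if the causally convex hull $J^+(K)\cap J^-(K)$ is compact for every compact $K\subset M$. No causality condition is assumed on $(M,g)$. -/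

import Mathlib

open scoped Manifold ContDiff

/-- The components of a field `g` of bilinear forms on the tangent spaces of `M` in the chart `e`:
at the point `y` of the target of `e` the constant vectors `v`, `w` of the coordinate space are
pushed forward by the differential of `e.symm` and inserted into `g (e.symm y)`. -/
noncomputable def componentInChart {d : ℕ} {M : Type*} [TopologicalSpace M]
    [ChartedSpace (EuclideanSpace ℝ (Fin d)) M]
    (g : ∀ p : M, TangentSpace (𝓡 d) p →L[ℝ] TangentSpace (𝓡 d) p →L[ℝ] ℝ)
    (e : OpenPartialHomeomorph M (EuclideanSpace ℝ (Fin d)))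
    (v w : EuclideanSpace ℝ (Fin d)) (y : EuclideanSpace ℝ (Fin d)) : ℝ :=
  g (e.symm y) (mfderiv (𝓡 d) (𝓡 d) e.symm y v) (mfderiv (𝓡 d) (𝓡 d) e.symm y w)

/-- A field of bilinear forms is of class `C^{1,1}` if in every chart of the atlas its components
are continuously differentiable and their first derivatives are locally Lipschitz. -/
def IsC11Tensor {d : ℕ} {M : Type*} [TopologicalSpace M]
    [ChartedSpace (EuclideanSpace ℝ (Fin d)) M]
    (g : ∀ p : M, TangentSpace (𝓡 d) p →L[ℝ] TangentSpace (𝓡 d) p →L[ℝ] ℝ) : Prop :=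
  ∀ e ∈ atlas (EuclideanSpace ℝ (Fin d)) M, ∀ v w : EuclideanSpace ℝ (Fin d),
    ContDiffOn ℝ 1 (componentInChart g e v w) e.target ∧
      LocallyLipschitzOn e.target (fderiv ℝ (componentInChart g e v w))

/-- A time-oriented Lorentzian structure on an `(n+1)`-dimensional manifold `M`: a metric of class
`C^{1,1}` and of signature `(-,+,…,+)`, with a time orientation, given by a continuous timelike
vector field. -/
structure TimeOrientedLorentzian (n : ℕ) (M : Type*) [TopologicalSpace M]
    [ChartedSpace (EuclideanSpace ℝ (Fin (n + 1))) M] [IsManifold (𝓡 (n + 1)) ∞ M] where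
  /-- The metric tensor. -/
  metric : ∀ p : M, TangentSpace (𝓡 (n + 1)) p →L[ℝ] TangentSpace (𝓡 (n + 1)) p →L[ℝ] ℝ
  symm : ∀ (p : M) (v w : TangentSpace (𝓡 (n + 1)) p), metric p v w = metric p w v
  regular : IsC11Tensor metric
  /-- Every tangent space has an orthonormal basis of signature `(-,+,…,+)`. -/
  signature : ∀ p : M, ∃ b : Module.Basis (Fin (n + 1)) ℝ (TangentSpace (𝓡 (n + 1)) p),
    ∀ i j, metric p (b i) (b j) = if i = j then (if i = 0 then -1 else 1) else 0
  /-- The vector field that gives the time orientation. -/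
  timeField : ∀ p : M, TangentSpace (𝓡 (n + 1)) p
  timeField_continuous :
    Continuous (fun p : M => (⟨p, timeField p⟩ : TangentBundle (𝓡 (n + 1)) M))
  timeField_timelike : ∀ p : M, metric p (timeField p) (timeField p) < 0

namespace TimeOrientedLorentzian

variable {n : ℕ} {M : Type*} [TopologicalSpace M]
  [ChartedSpace (EuclideanSpace ℝ (Fin (n + 1))) M] [IsManifold (𝓡 (n + 1)) ∞ M]

/-- A tangent vector is causal if it is non-zero and not spacelike; it is future-directed if it
lies in the same half of the causal cone as the vector field of the time orientation. -/
def IsFutureCausal (S : TimeOrientedLorentzian n M) (p : M)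
    (v : TangentSpace (𝓡 (n + 1)) p) : Prop :=
  v ≠ 0 ∧ S.metric p v v ≤ 0 ∧ S.metric p (S.timeField p) v < 0

/-- `γ` restricted to `[a, b]` is a `C^1` future-directed causal curve (one-sided derivatives at
the endpoints). -/
def IsC1CausalCurve (S : TimeOrientedLorentzian n M) (γ : ℝ → M) (a b : ℝ) : Prop :=
  a < b ∧ ContMDiffOn 𝓘(ℝ, ℝ) (𝓡 (n + 1)) 1 γ (Set.Icc a b) ∧
    ∀ t ∈ Set.Icc a b, S.IsFutureCausal (γ t)
      (mfderivWithin 𝓘(ℝ, ℝ) (𝓡 (n + 1)) γ (Set.Icc a b) t (1 : ℝ))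

/-- `γ` restricted to `[a, b]` is a piecewise `C^1` future-directed causal curve: `[a, b]` is the
union of finitely many consecutive intervals on each of which `γ` is a `C^1` future-directed
causal curve. -/
inductive IsCausalCurve (S : TimeOrientedLorentzian n M) (γ : ℝ → M) : ℝ → ℝ → Prop
  | segment {a b : ℝ} (h : S.IsC1CausalCurve γ a b) : IsCausalCurve S γ a b
  | concat {a b c : ℝ} (h₁ : IsCausalCurve S γ a b) (h₂ : IsCausalCurve S γ b c) :
      IsCausalCurve S γ a c

/-- `p < q`: some future-directed causal curve goes from `p` to `q`. -/
def CausallyBefore (S : TimeOrientedLorentzian n M) (p q : M) : Prop :=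
  ∃ (γ : ℝ → M) (a b : ℝ), S.IsCausalCurve γ a b ∧ γ a = p ∧ γ b = q

/-- The causal relation `p ≤ q`: `p < q` or `p = q`. -/
def CausalRel (S : TimeOrientedLorentzian n M) (p q : M) : Prop :=
  S.CausallyBefore p q ∨ p = q

/-- The causal future `J⁺(A)` of a set. -/
def causalFuture (S : TimeOrientedLorentzian n M) (A : Set M) : Set M :=
  {q | ∃ p ∈ A, S.CausalRel p q}

/-- The causal past `J⁻(A)` of a set. -/
def causalPast (S : TimeOrientedLorentzian n M) (A : Set M) : Set M :=
  {q | ∃ p ∈ A, S.CausalRel q p}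

/-- The causal diamond `J⁺(p) ∩ J⁻(q)`. -/
def causalDiamond (S : TimeOrientedLorentzian n M) (p q : M) : Set M :=
  S.causalFuture {p} ∩ S.causalPast {q}

/-- The causally convex hull `J⁺(A) ∩ J⁻(A)` of a set. -/
def causalHull (S : TimeOrientedLorentzian n M) (A : Set M) : Set M :=
  S.causalFuture A ∩ S.causalPast A

end TimeOrientedLorentzian

/-!
The argument separates into a topological part and a geometric part.

Call a reflexive transitive relation on a topological space *locally cofinal* if every
neighbourhood of every point `p` contains a point `p'` whose future is a neighbourhood of `p` and
a point `p''` whose past is a neighbourhood of `p`. For such a relation, if all diamonds are closed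
and `r` is a limit of points `x` with `a ≤ x ≤ b`, where `a`, `b` vary in a compact set `K`, one may
assume `a → p` and `b → q`. If the future of `p'` is a neighbourhood of `p` and the past of `q'` is
a neighbourhood of `q`, then eventually `p' ≤ a ≤ x ≤ b ≤ q'`, whence `p' ≤ r ≤ q'` because the
diamond is closed. Once one such `p'` is fixed, all the other choices close enough to `p` lie in
the closed set `J⁺(p') ∩ J⁻(r)` and accumulate at `p`, so `p ≤ r`; likewise `r ≤ q`. This is
`isClosed_hull_of_isClosed_diamond`. Compactness follows since `K` is covered by the futures of
finitely many points, and by the pasts of finitely many points, so that its hull is a closed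
subset of a finite union of diamonds. In the other direction, for `p ≤ q` the diamond of `p` and
`q` is the hull of `{p, q}`, and otherwise it is empty.

The causal relation is transitive because causal curves can be shifted in time and concatenated. It
is locally cofinal because, in a chart around `p`, the future timelike cone contains a fixed open
neighbourhood `W` of the vector `v₀` of the time orientation at `p`, uniformly over a ball around
`p` (`eventually_isFutureCausal_mfderiv_symm`). Straight segments in that ball with
velocity in `W` are therefore causal curves, and those which start at `p - s v₀` reach a full
neighbourhood of `p`. Only the continuity of the metric is needed here.
-/

open Set Filter Topology

/-! ### Reflexive transitive relations with locally cofinal futures and pasts -/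

section Relation

variable {X : Type*} [TopologicalSpace X] {R : X → X → Prop}

/-- If all diamonds are closed, then `p` precedes `r` as soon as the
points `a` close to `p` whose future is a neighbourhood of `p` precede `r`. -/
lemma rel_of_forall_future_mem_nhds
    (hpast : ∀ p, ∀ U ∈ 𝓝 p, ∃ a ∈ U, {x | R a x} ∈ 𝓝 p)
    (hclosed : ∀ a b, IsClosed {x | R a x ∧ R x b}) {p r : X}
    (h : ∀ a, {x | R a x} ∈ 𝓝 p → R a r) : R p r := by
  obtain ⟨a, -, ha⟩ := hpast p univ univ_mem
  -- Points near `p` whose future is a neighbourhood of `p` lie in the future of `a`.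
  have hp : p ∈ closure {x | R a x ∧ R x r} := by
    rw [mem_closure_iff_nhds]
    intro U hU
    obtain ⟨b, hb, hbp⟩ := hpast p (U ∩ {x | R a x}) (inter_mem hU ha)
    exact ⟨b, hb.1, hb.2, h b hbp⟩
  rw [(hclosed a r).closure_eq] at hp
  exact hp.2

lemma isClosed_hull_of_isClosed_diamond (htrans : ∀ a b c, R a b → R b c → R a c)
    (hpast : ∀ p, ∀ U ∈ 𝓝 p, ∃ a ∈ U, {x | R a x} ∈ 𝓝 p)
    (hfut : ∀ p, ∀ U ∈ 𝓝 p, ∃ b ∈ U, {x | R x b} ∈ 𝓝 p)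
    (hclosed : ∀ a b, IsClosed {x | R a x ∧ R x b}) {K : Set X} (hK : IsCompact K) :
    IsClosed {x | (∃ a ∈ K, R a x) ∧ ∃ b ∈ K, R x b} := by
  rw [isClosed_iff_ultrafilter]
  intro r u hur hu
  have hu' : ∀ᶠ x in (u : Filter X), (∃ a ∈ K, R a x) ∧ ∃ b ∈ K, R x b := hu
  have hA : ∀ᶠ x in (u : Filter X), ∃ a, a ∈ K ∧ R a x := hu'.mono fun x hx => hx.1
  have hB : ∀ᶠ x in (u : Filter X), ∃ b, b ∈ K ∧ R x b := hu'.mono fun x hx => hx.2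
  obtain ⟨f, hf⟩ := hA.choice
  obtain ⟨g, hg⟩ := hB.choice
  obtain ⟨p, hpK, hp⟩ := hK.ultrafilter_le_nhds (u.map f)
    (le_principal_iff.2 (hf.mono fun x hx => hx.1))
  obtain ⟨q, hqK, hq⟩ := hK.ultrafilter_le_nhds (u.map g)
    (le_principal_iff.2 (hg.mono fun x hx => hx.1))
  have key : ∀ a b, {x | R a x} ∈ 𝓝 p → {x | R x b} ∈ 𝓝 q → R a r ∧ R r b := by
    intro a b ha hb
    refine isClosed_iff_ultrafilter.1 (hclosed a b) r u hur ?_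
    have h1 : ∀ᶠ x in (u : Filter X), R a (f x) := hp ha
    have h2 : ∀ᶠ x in (u : Filter X), R (g x) b := hq hb
    filter_upwards [h1, h2, hf, hg] with x h1 h2 hfx hgx
    exact ⟨htrans _ _ _ h1 hfx.2, htrans _ _ _ hgx.2 h2⟩
  obtain ⟨a₀, -, ha₀⟩ := hpast p univ univ_mem
  obtain ⟨b₀, -, hb₀⟩ := hfut q univ univ_mem
  refine ⟨⟨p, hpK, ?_⟩, q, hqK, ?_⟩
  · exact rel_of_forall_future_mem_nhds hpast hclosed fun a ha => (key a b₀ ha hb₀).1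
  · refine rel_of_forall_future_mem_nhds (R := fun x y => R y x) hfut (fun a b => ?_)
      fun b hb => (key a₀ b ha₀ hb).2
    simpa only [and_comm] using hclosed b a

lemma isCompact_hull_of_isCompact_diamond [T2Space X] (htrans : ∀ a b c, R a b → R b c → R a c)
    (hpast : ∀ p, ∀ U ∈ 𝓝 p, ∃ a ∈ U, {x | R a x} ∈ 𝓝 p)
    (hfut : ∀ p, ∀ U ∈ 𝓝 p, ∃ b ∈ U, {x | R x b} ∈ 𝓝 p)
    (hcompact : ∀ a b, IsCompact {x | R a x ∧ R x b}) {K : Set X} (hK : IsCompact K) :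
    IsCompact {x | (∃ a ∈ K, R a x) ∧ ∃ b ∈ K, R x b} := by
  have hP : ∀ p, ∃ a, {x | R a x} ∈ 𝓝 p := fun p =>
    (hpast p univ univ_mem).imp fun a ha => ha.2
  have hF : ∀ p, ∃ b, {x | R x b} ∈ 𝓝 p := fun p =>
    (hfut p univ univ_mem).imp fun b hb => hb.2
  choose α hα using hP
  choose β hβ using hF
  obtain ⟨s, -, hs⟩ := hK.elim_nhds_subcover (fun p => {x | R (α p) x}) fun p _ => hα p
  obtain ⟨t, -, ht⟩ := hK.elim_nhds_subcover (fun p => {x | R x (β p)}) fun p _ => hβ p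
  refine IsCompact.of_isClosed_subset
    (s.isCompact_biUnion fun i _ => t.isCompact_biUnion fun j _ => hcompact (α i) (β j))
    (isClosed_hull_of_isClosed_diamond htrans hpast hfut (fun a b => (hcompact a b).isClosed) hK)
    ?_
  rintro x ⟨⟨a, haK, hax⟩, b, hbK, hxb⟩
  obtain ⟨i, hi, hia⟩ := mem_iUnion₂.1 (hs haK)
  obtain ⟨j, hj, hjb⟩ := mem_iUnion₂.1 (ht hbK)
  exact mem_iUnion₂.2 ⟨i, hi, mem_iUnion₂.2
    ⟨j, hj, htrans _ _ _ hia hax, htrans _ _ _ hxb hjb⟩⟩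

omit [TopologicalSpace X] in
/-- For `p ≤ q` the diamond of `p` and `q` is the hull of `{p, q}`; otherwise it is empty. -/
lemma diamond_eq_empty_or_eq_hull_pair (htrans : ∀ a b c, R a b → R b c → R a c) (p q : X) :
    {x | R p x ∧ R x q} = ∅ ∨ {x | R p x ∧ R x q} =
      {x | (∃ a ∈ ({p, q} : Set X), R a x) ∧ ∃ b ∈ ({p, q} : Set X), R x b} := by
  by_cases hpq : R p q
  · right
    ext x
    have h1 : R q x → R p x := htrans _ _ _ hpq
    have h2 : R x p → R x q := fun h => htrans _ _ _ h hpq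
    simp only [mem_ofPred_eq, mem_insert_iff, mem_singleton_iff, exists_eq_or_imp, exists_eq_left]
    tauto
  · left
    exact eq_empty_of_forall_notMem fun x hx => hpq (htrans _ _ _ hx.1 hx.2)

end Relation

namespace TimeOrientedLorentzian

variable {n : ℕ} {M : Type*} [TopologicalSpace M]
  [ChartedSpace (EuclideanSpace ℝ (Fin (n + 1))) M] [IsManifold (𝓡 (n + 1)) ∞ M]
  {S : TimeOrientedLorentzian n M}

/-! ### Concatenation of causal curves -/

lemma IsC1CausalCurve.congr {γ η : ℝ → M} {a b : ℝ} (h : S.IsC1CausalCurve γ a b)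
    (heq : EqOn η γ (Icc a b)) : S.IsC1CausalCurve η a b := by
  refine ⟨h.1, h.2.1.congr heq, fun t ht => ?_⟩
  have h1 := h.2.2 t ht
  rw [← mfderivWithin_congr_of_mem heq ht] at h1
  have h2 : η t = γ t := heq ht
  generalize mfderivWithin 𝓘(ℝ, ℝ) (𝓡 (n + 1)) η (Icc a b) t (1 : ℝ) = v at h1 ⊢
  change EuclideanSpace ℝ (Fin (n + 1)) at v
  change S.IsFutureCausal (η t) v
  rw [h2]
  exact h1

lemma IsCausalCurve.lt {γ : ℝ → M} {a b : ℝ} (h : S.IsCausalCurve γ a b) : a < b := by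
  induction h with
  | segment h => exact h.1
  | concat _ _ h₁ h₂ => exact h₁.trans h₂

lemma IsCausalCurve.congr {γ η : ℝ → M} {a b : ℝ} (h : S.IsCausalCurve γ a b)
    (heq : EqOn η γ (Icc a b)) : S.IsCausalCurve η a b := by
  induction h with
  | segment h => exact .segment (h.congr heq)
  | concat h₁ h₂ ih₁ ih₂ =>
    exact .concat (ih₁ (heq.mono (Icc_subset_Icc_right h₂.lt.le)))
      (ih₂ (heq.mono (Icc_subset_Icc_left h₁.lt.le)))

lemma IsC1CausalCurve.comp_sub {γ : ℝ → M} {a b : ℝ} (h : S.IsC1CausalCurve γ a b) (c : ℝ) :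
    S.IsC1CausalCurve (γ ∘ fun t => t - c) (a + c) (b + c) := by
  have hlt : a + c < b + c := by linarith [h.1]
  have hmaps : MapsTo (fun t : ℝ => t - c) (Icc (a + c) (b + c)) (Icc a b) := fun t ht =>
    ⟨by linarith [ht.1], by linarith [ht.2]⟩
  have hsub : ContDiff ℝ 1 fun t : ℝ => t - c := by fun_prop
  refine ⟨hlt, h.2.1.comp hsub.contMDiff.contMDiffOn hmaps, fun t ht => ?_⟩
  have hd : HasMFDerivWithinAt 𝓘(ℝ, ℝ) 𝓘(ℝ, ℝ) (fun t : ℝ => t - c) (Icc (a + c) (b + c)) t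
      (ContinuousLinearMap.id ℝ ℝ) :=
    ((hasFDerivAt_id t).sub_const c).hasFDerivWithinAt.hasMFDerivWithinAt
  have hγ := ((h.2.1 _ (hmaps ht)).mdifferentiableWithinAt one_ne_zero).hasMFDerivWithinAt
  have hcomp := (HasMFDerivWithinAt.comp t hγ hd hmaps.subset_preimage).mfderivWithin
    ((uniqueDiffOn_Icc hlt) t ht).uniqueMDiffWithinAt
  rw [hcomp]
  exact h.2.2 _ (hmaps ht)

lemma IsCausalCurve.comp_sub {γ : ℝ → M} {a b : ℝ} (h : S.IsCausalCurve γ a b) (c : ℝ) :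
    S.IsCausalCurve (γ ∘ fun t => t - c) (a + c) (b + c) := by
  induction h with
  | segment h => exact .segment (h.comp_sub c)
  | concat _ _ ih₁ ih₂ => exact .concat ih₁ ih₂

lemma CausallyBefore.trans {p q r : M} (hpq : S.CausallyBefore p q) (hqr : S.CausallyBefore q r) :
    S.CausallyBefore p r := by
  obtain ⟨γ, a, b, hγ, rfl, rfl⟩ := hpq
  obtain ⟨η, c, d, hη, hc, rfl⟩ := hqr
  -- The second curve is shifted so that it starts at time `b`.
  have hη' := hη.comp_sub (b - c)
  rw [add_sub_cancel] at hη'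
  have hlt := hη'.lt
  refine ⟨fun t => if t ≤ b then γ t else η (t - (b - c)), a, d + (b - c),
    .concat (b := b) (hγ.congr fun t ht => if_pos ht.2) (hη'.congr fun t ht => ?_),
    if_pos hγ.lt.le, ?_⟩
  · rcases ht.1.eq_or_lt with rfl | h
    · simp [hc]
    · simp [h.not_ge]
  · simp [hlt.not_ge]

lemma CausalRel.trans {p q r : M} (hpq : S.CausalRel p q) (hqr : S.CausalRel q r) :
    S.CausalRel p r := by
  rcases hpq with hpq | rfl
  · rcases hqr with hqr | rfl
    · exact .inl (hpq.trans hqr)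
    · exact .inl hpq
  · exact hqr

/-! ### Causal segments in a chart -/

/-- The components of the metric in a chart depend continuously on the point and on both
vectors. -/
lemma continuousAt_componentInChart (S : TimeOrientedLorentzian n M)
    {e : OpenPartialHomeomorph M (EuclideanSpace ℝ (Fin (n + 1)))}
    (he : e ∈ atlas (EuclideanSpace ℝ (Fin (n + 1))) M)
    {x : EuclideanSpace ℝ (Fin (n + 1)) × EuclideanSpace ℝ (Fin (n + 1)) ×
      EuclideanSpace ℝ (Fin (n + 1))} (hx : x.1 ∈ e.target) :
    ContinuousAt (fun z : EuclideanSpace ℝ (Fin (n + 1)) × EuclideanSpace ℝ (Fin (n + 1)) ×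
      EuclideanSpace ℝ (Fin (n + 1)) => componentInChart S.metric e z.2.1 z.2.2 z.1) x := by
  set b := EuclideanSpace.basisFun (Fin (n + 1)) ℝ
  have hexp : (fun z : EuclideanSpace ℝ (Fin (n + 1)) × EuclideanSpace ℝ (Fin (n + 1)) ×
      EuclideanSpace ℝ (Fin (n + 1)) => componentInChart S.metric e z.2.1 z.2.2 z.1) =
      fun z => ∑ i, ∑ j, z.2.1 i * (z.2.2 j * componentInChart S.metric e (b i) (b j) z.1) := by
    funext z
    let A : EuclideanSpace ℝ (Fin (n + 1)) →L[ℝ] TangentSpace (𝓡 (n + 1)) (e.symm z.1) :=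
      mfderiv (𝓡 (n + 1)) (𝓡 (n + 1)) e.symm z.1
    change S.metric (e.symm z.1) (A z.2.1) (A z.2.2) = ∑ i, ∑ j, z.2.1 i * (z.2.2 j *
      S.metric (e.symm z.1) (A (b i)) (A (b j)))
    conv_lhs => rw [← b.sum_repr z.2.1, ← b.sum_repr z.2.2]
    simp only [map_sum, map_smul, sum_apply, smul_apply,
      smul_eq_mul, Finset.mul_sum]
    rw [Finset.sum_comm]
    refine Finset.sum_congr rfl fun i _ => Finset.sum_congr rfl fun j _ => ?_
    exact mul_left_comm _ _ _
  rw [hexp]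
  refine tendsto_finsetSum _ fun i _ => tendsto_finsetSum _ fun j _ => ?_
  have hc : ContinuousAt (componentInChart S.metric e (b i) (b j)) x.1 :=
    ((S.regular e he (b i) (b j)).1.continuousOn).continuousAt (e.open_target.mem_nhds hx)
  have hc' : ContinuousAt (fun z : EuclideanSpace ℝ (Fin (n + 1)) ×
      EuclideanSpace ℝ (Fin (n + 1)) × EuclideanSpace ℝ (Fin (n + 1)) =>
      componentInChart S.metric e (b i) (b j) z.1) x :=
    ContinuousAt.comp (f := Prod.fst) hc continuousAt_fst
  have h1 : ContinuousAt (fun z : EuclideanSpace ℝ (Fin (n + 1)) ×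
      EuclideanSpace ℝ (Fin (n + 1)) × EuclideanSpace ℝ (Fin (n + 1)) => z.2.1 i) x := by fun_prop
  have h2 : ContinuousAt (fun z : EuclideanSpace ℝ (Fin (n + 1)) ×
      EuclideanSpace ℝ (Fin (n + 1)) × EuclideanSpace ℝ (Fin (n + 1)) => z.2.2 j) x := by fun_prop
  exact h1.mul (h2.mul hc')

/-- In the chart at `p` there is a vector `v₀`, representing the time orientation at `p`, such
that all vectors close to `v₀` are future-directed causal at all points close to `p`. -/
lemma eventually_isFutureCausal_mfderiv_symm (S : TimeOrientedLorentzian n M) (p : M) :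
    ∃ v₀ : EuclideanSpace ℝ (Fin (n + 1)),
      ∀ᶠ z : EuclideanSpace ℝ (Fin (n + 1)) × EuclideanSpace ℝ (Fin (n + 1)) in
        𝓝 (chartAt (EuclideanSpace ℝ (Fin (n + 1))) p p, v₀),
        z.1 ∈ (chartAt (EuclideanSpace ℝ (Fin (n + 1))) p).target ∧
        S.IsFutureCausal ((chartAt (EuclideanSpace ℝ (Fin (n + 1))) p).symm z.1)
          (mfderiv (𝓡 (n + 1)) (𝓡 (n + 1))
            (chartAt (EuclideanSpace ℝ (Fin (n + 1))) p).symm z.1 z.2) := by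
  set e := chartAt (EuclideanSpace ℝ (Fin (n + 1))) p
  have hmem : e ∈ atlas (EuclideanSpace ℝ (Fin (n + 1))) M := chart_mem_atlas _ p
  have hpt : e p ∈ e.target := mem_chart_target _ p
  have hsymm : e.symm (e p) = p := e.left_inv (mem_chart_source _ p)
  -- `σ` is the time field in the trivialization given by the chart at `p`.
  set σ : M → EuclideanSpace ℝ (Fin (n + 1)) := fun x =>
    (trivializationAt (EuclideanSpace ℝ (Fin (n + 1))) (TangentSpace (𝓡 (n + 1))) p
      (⟨x, S.timeField x⟩ : TangentBundle (𝓡 (n + 1)) M)).2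
  have hσ : ContinuousAt σ p :=
    ((FiberBundle.continuousAt_totalSpace _ _).1 (S.timeField_continuous.continuousAt (x := p))).2
  have hτ : ContinuousAt (fun y => σ (e.symm y)) (e p) := by
    refine ContinuousAt.comp (g := σ) ?_ (e.continuousAt_symm hpt)
    rwa [hsymm]
  -- On the chart domain that trivialization is the differential of the chart, so the inverse chart
  -- pushes `σ` forward to the time field.
  have hpush : ∀ y ∈ e.target, mfderiv (𝓡 (n + 1)) (𝓡 (n + 1)) e.symm y (σ (e.symm y)) =
      S.timeField (e.symm y) := by
    intro y hy
    have hys : e.symm y ∈ e.source := e.map_target hy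
    have h1 : σ (e.symm y) =
        mfderiv (𝓡 (n + 1)) (𝓡 (n + 1)) e (e.symm y) (S.timeField (e.symm y)) := by
      have := TangentBundle.continuousLinearMapAt_trivializationAt (I := 𝓡 (n + 1))
        (x₀ := p) hys
      have h2 := congr($this (S.timeField (e.symm y)))
      rw [Bundle.Trivialization.continuousLinearMapAt_apply,
        Bundle.Trivialization.linearMapAt_apply, if_pos] at h2
      · exact h2
      · simpa using hys
    have h3 := (mdifferentiable_chart (I := 𝓡 (n + 1)) p).symm_comp_deriv hys
    rw [e.right_inv hy] at h3
    rw [h1]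
    exact congr($h3 (S.timeField (e.symm y)))
  set v₀ := σ p
  have hneg : componentInChart S.metric e v₀ v₀ (e p) < 0 := by
    have h := hpush (e p) hpt
    have h2 := S.timeField_timelike (e.symm (e p))
    rw [← h] at h2
    have h3 : σ (e.symm (e p)) = v₀ := by rw [hsymm]
    rw [h3] at h2
    exact h2
  refine ⟨v₀, ?_⟩
  have hc1 : ContinuousAt (fun z : EuclideanSpace ℝ (Fin (n + 1)) ×
      EuclideanSpace ℝ (Fin (n + 1)) => componentInChart S.metric e z.2 z.2 z.1) (e p, v₀) :=
    ContinuousAt.comp (x := (e p, v₀)) (f := fun z : EuclideanSpace ℝ (Fin (n + 1)) ×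
      EuclideanSpace ℝ (Fin (n + 1)) => (z.1, z.2, z.2))
      (continuousAt_componentInChart S hmem (x := (e p, v₀, v₀)) hpt) (by fun_prop)
  have hτ' : ContinuousAt (fun z : EuclideanSpace ℝ (Fin (n + 1)) ×
      EuclideanSpace ℝ (Fin (n + 1)) => σ (e.symm z.1)) (e p, v₀) :=
    ContinuousAt.comp (x := (e p, v₀)) (f := Prod.fst) hτ continuousAt_fst
  have hc2 : ContinuousAt (fun z : EuclideanSpace ℝ (Fin (n + 1)) ×
      EuclideanSpace ℝ (Fin (n + 1)) => componentInChart S.metric e (σ (e.symm z.1)) z.2 z.1)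
      (e p, v₀) :=
    ContinuousAt.comp (x := (e p, v₀)) (f := fun z : EuclideanSpace ℝ (Fin (n + 1)) ×
      EuclideanSpace ℝ (Fin (n + 1)) => (z.1, σ (e.symm z.1), z.2))
      (continuousAt_componentInChart S hmem (x := (e p, σ (e.symm (e p)), v₀)) hpt)
      (continuousAt_fst.prodMk (hτ'.prodMk continuousAt_snd))
  have hneg2 : componentInChart S.metric e (σ (e.symm (e p))) v₀ (e p) < 0 := by
    rw [hsymm]
    exact hneg
  filter_upwards [hc1.eventually_lt_const hneg, hc2.eventually_lt_const hneg2,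
    continuousAt_fst.eventually (e.open_target.mem_nhds hpt)] with z h1 h2 hz
  refine ⟨hz, fun h0 => ?_, h1.le, ?_⟩
  · unfold componentInChart at h1
    rw [h0] at h1
    simp at h1
  · unfold componentInChart at h2
    rwa [hpush _ hz] at h2

/-- In the chart at `p`, a segment in a small ball around `p` whose velocity is close to the vector
`v₀` of the time orientation is a causal curve. -/
lemma exists_causallyBefore_of_segment (S : TimeOrientedLorentzian n M) (p : M) :
    ∃ v₀ : EuclideanSpace ℝ (Fin (n + 1)), ∃ δ > 0,
      ∀ x ∈ Metric.ball (chartAt (EuclideanSpace ℝ (Fin (n + 1))) p p) δ,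
      ∀ y ∈ Metric.ball (chartAt (EuclideanSpace ℝ (Fin (n + 1))) p p) δ,
      ∀ s : ℝ, 0 < s → s⁻¹ • (y - x) ∈ Metric.ball v₀ δ →
        S.CausallyBefore ((chartAt (EuclideanSpace ℝ (Fin (n + 1))) p).symm x)
          ((chartAt (EuclideanSpace ℝ (Fin (n + 1))) p).symm y) := by
  obtain ⟨v₀, hv₀⟩ := eventually_isFutureCausal_mfderiv_symm S p
  obtain ⟨δ, hδ, hball⟩ := Metric.eventually_nhds_iff_ball.1 hv₀
  refine ⟨v₀, δ, hδ, fun x hx y hy s hs hv => ?_⟩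
  set e := chartAt (EuclideanSpace ℝ (Fin (n + 1))) p
  set v := s⁻¹ • (y - x)
  have hsv : s • v = y - x := smul_inv_smul₀ hs.ne' _
  have hmaps : ∀ t ∈ Icc 0 s, x + t • v ∈ Metric.ball (e p) δ := by
    intro t ht
    have := (convex_ball (e p) δ).add_smul_sub_mem hx hy (t := t / s)
      ⟨div_nonneg ht.1 hs.le, (div_le_one hs).2 ht.2⟩
    rwa [div_eq_mul_inv, mul_smul] at this
  have hfut : ∀ t ∈ Icc 0 s, x + t • v ∈ e.target ∧ S.IsFutureCausal (e.symm (x + t • v))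
      (mfderiv (𝓡 (n + 1)) (𝓡 (n + 1)) e.symm (x + t • v) v) := fun t ht =>
    hball (x + t • v, v) (by
      rw [← ball_prod_same]
      exact ⟨hmaps t ht, hv⟩)
  have hline : ContDiff ℝ 1 fun t : ℝ => x + t • v := by fun_prop
  refine ⟨e.symm ∘ fun t : ℝ => x + t • v, 0, s, .segment ⟨hs, ?_, fun t ht => ?_⟩, ?_, ?_⟩
  · exact (contMDiffOn_chart_symm (I := 𝓡 (n + 1)) (n := 1) (x := p)).comp
      hline.contMDiff.contMDiffOn fun t ht => (hfut t ht).1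
  · have hd : HasMFDerivWithinAt 𝓘(ℝ, ℝ) (𝓡 (n + 1)) (fun t : ℝ => x + t • v) (Icc 0 s) t
        (ContinuousLinearMap.toSpanSingleton ℝ v) := by
      have h := (((hasDerivAt_id t).smul_const v).const_add x).hasFDerivAt
      rw [one_smul] at h
      exact h.hasFDerivWithinAt.hasMFDerivWithinAt
    have he := ((mdifferentiable_chart (I := 𝓡 (n + 1)) p).mdifferentiableAt_symm
      (hfut t ht).1).hasMFDerivAt
    have hcomp := (HasMFDerivAt.comp_hasMFDerivWithinAt t he hd).mfderivWithin
      ((uniqueDiffOn_Icc hs) t ht).uniqueMDiffWithinAt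
    rw [hcomp]
    have h1 : (ContinuousLinearMap.toSpanSingleton ℝ v) (1 : ℝ) = v := by simp
    change S.IsFutureCausal (e.symm (x + t • v)) (mfderiv (𝓡 (n + 1)) (𝓡 (n + 1)) e.symm
      (x + t • v) ((ContinuousLinearMap.toSpanSingleton ℝ v) (1 : ℝ)))
    rw [h1]
    exact (hfut t ht).2
  · simp
  · simp [hsv]

/-- Arbitrarily close to `p` there are points whose causal future is a neighbourhood of `p`. -/
lemma exists_setOf_causalRel_right_mem_nhds (S : TimeOrientedLorentzian n M) (p : M) {U : Set M}
    (hU : U ∈ 𝓝 p) : ∃ a ∈ U, {x | S.CausalRel a x} ∈ 𝓝 p := by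
  obtain ⟨v₀, δ, hδ, hseg⟩ := S.exists_causallyBefore_of_segment p
  set e := chartAt (EuclideanSpace ℝ (Fin (n + 1))) p
  have hps : p ∈ e.source := mem_chart_source _ p
  have hball : Metric.ball (e p) δ ∈ 𝓝 (e p) := Metric.ball_mem_nhds _ hδ
  have hU' : ∀ᶠ y in 𝓝 (e p), e.symm y ∈ U := by
    refine (e.continuousAt_symm (e.map_source hps)).eventually_mem ?_
    rwa [e.left_inv hps]
  have hline : Tendsto (fun s : ℝ => e p - s • v₀) (𝓝[>] 0) (𝓝 (e p)) := by
    have h : Continuous fun s : ℝ => e p - s • v₀ := by fun_prop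
    simpa using (h.tendsto 0).mono_left nhdsWithin_le_nhds
  obtain ⟨s, ⟨hsU, hsball⟩, hs⟩ := ((hline.eventually (hU'.and hball)).and
    self_mem_nhdsWithin).exists
  have hvel : ContinuousAt (fun z => s⁻¹ • (z - (e p - s • v₀))) (e p) := by fun_prop
  have hvel' : ∀ᶠ z in 𝓝 (e p), s⁻¹ • (z - (e p - s • v₀)) ∈ Metric.ball v₀ δ := by
    refine hvel.eventually_mem ?_
    simpa [inv_smul_smul₀ (ne_of_gt hs)] using Metric.ball_mem_nhds v₀ hδ
  refine ⟨e.symm (e p - s • v₀), hsU, ?_⟩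
  filter_upwards [(e.continuousAt hps).eventually (hvel'.and hball), e.open_source.mem_nhds hps]
    with x hx hxs
  have h := hseg _ hsball _ hx.2 s hs hx.1
  rw [e.left_inv hxs] at h
  exact .inl h

/-- Arbitrarily close to `p` there are points whose causal past is a neighbourhood of `p`. -/
lemma exists_setOf_causalRel_left_mem_nhds (S : TimeOrientedLorentzian n M) (p : M) {U : Set M}
    (hU : U ∈ 𝓝 p) : ∃ b ∈ U, {x | S.CausalRel x b} ∈ 𝓝 p := by
  obtain ⟨v₀, δ, hδ, hseg⟩ := S.exists_causallyBefore_of_segment p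
  set e := chartAt (EuclideanSpace ℝ (Fin (n + 1))) p
  have hps : p ∈ e.source := mem_chart_source _ p
  have hball : Metric.ball (e p) δ ∈ 𝓝 (e p) := Metric.ball_mem_nhds _ hδ
  have hU' : ∀ᶠ y in 𝓝 (e p), e.symm y ∈ U := by
    refine (e.continuousAt_symm (e.map_source hps)).eventually_mem ?_
    rwa [e.left_inv hps]
  have hline : Tendsto (fun s : ℝ => e p + s • v₀) (𝓝[>] 0) (𝓝 (e p)) := by
    have h : Continuous fun s : ℝ => e p + s • v₀ := by fun_prop
    simpa using (h.tendsto 0).mono_left nhdsWithin_le_nhds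
  obtain ⟨s, ⟨hsU, hsball⟩, hs⟩ := ((hline.eventually (hU'.and hball)).and
    self_mem_nhdsWithin).exists
  have hvel : ContinuousAt (fun z => s⁻¹ • (e p + s • v₀ - z)) (e p) := by fun_prop
  have hvel' : ∀ᶠ z in 𝓝 (e p), s⁻¹ • (e p + s • v₀ - z) ∈ Metric.ball v₀ δ := by
    refine hvel.eventually_mem ?_
    simpa [inv_smul_smul₀ (ne_of_gt hs)] using Metric.ball_mem_nhds v₀ hδ
  refine ⟨e.symm (e p + s • v₀), hsU, ?_⟩
  filter_upwards [(e.continuousAt hps).eventually (hvel'.and hball), e.open_source.mem_nhds hps]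
    with x hx hxs
  have h := hseg _ hx.2 _ hsball s hs hx.1
  rw [e.left_inv hxs] at h
  exact .inl h

end TimeOrientedLorentzian

theorem proposition2 (n : ℕ) (M : Type*) [TopologicalSpace M] [T2Space M]
    [SecondCountableTopology M] [ConnectedSpace M]
    [ChartedSpace (EuclideanSpace ℝ (Fin (n + 1))) M] [IsManifold (𝓡 (n + 1)) ∞ M]
    (S : TimeOrientedLorentzian n M) :
    ((∀ p q : M, IsClosed (S.causalDiamond p q)) ↔
        ∀ K : Set M, IsCompact K → IsClosed (S.causalHull K)) ∧
      ((∀ p q : M, IsCompact (S.causalDiamond p q)) ↔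
        ∀ K : Set M, IsCompact K → IsCompact (S.causalHull K)) := by
  have hdiamond : ∀ p q, S.causalDiamond p q = {x | S.CausalRel p x ∧ S.CausalRel x q} := by
    intro p q
    ext x
    simp [TimeOrientedLorentzian.causalDiamond, TimeOrientedLorentzian.causalFuture,
      TimeOrientedLorentzian.causalPast]
  have hhull : ∀ K, S.causalHull K =
      {x | (∃ a ∈ K, S.CausalRel a x) ∧ ∃ b ∈ K, S.CausalRel x b} := fun K => rfl
  have htrans : ∀ a b c, S.CausalRel a b → S.CausalRel b c → S.CausalRel a c :=
    fun a b c => TimeOrientedLorentzian.CausalRel.trans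
  have hpast : ∀ p, ∀ U ∈ 𝓝 p, ∃ a ∈ U, {x | S.CausalRel a x} ∈ 𝓝 p :=
    fun p U hU => S.exists_setOf_causalRel_right_mem_nhds p hU
  have hfut : ∀ p, ∀ U ∈ 𝓝 p, ∃ b ∈ U, {x | S.CausalRel x b} ∈ 𝓝 p :=
    fun p U hU => S.exists_setOf_causalRel_left_mem_nhds p hU
  simp only [hdiamond, hhull]
  refine ⟨⟨fun h K hK => isClosed_hull_of_isClosed_diamond htrans hpast hfut h hK,
    fun h p q => ?_⟩, ⟨fun h K hK => isCompact_hull_of_isCompact_diamond htrans hpast hfut h hK,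
    fun h p q => ?_⟩⟩
  · rcases diamond_eq_empty_or_eq_hull_pair htrans p q with h0 | h0 <;> rw [h0]
    · exact isClosed_empty
    · exact h _ (toFinite _).isCompact
  · rcases diamond_eq_empty_or_eq_hull_pair htrans p q with h0 | h0 <;> rw [h0]
    · exact isCompact_empty
    · exact h _ (toFinite _).isCompact
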